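/- Let $\mathbb M_n$ be the space of complex $n\times n$ matrices. For $Z\in\mathbb M_n$ let $|Z|=(Z^*Z)^{1/2}$, $\Re Z=\frac{Z+Z^*}{2}$ and $\Im Z=\frac{Z-Z^*}{2i}$, and define the arithmetic and the quadratic symmetric modulus of $Z$ by $$|Z|_{\mathrm{sym}}=\frac{|Z|+|Z^*|}{2},\qquad |Z|_{\mathrm{qsym}}=\sqrt{(\Re Z)^2+(\Im Z)^2}.$$ A norm $\|\cdot\|$ on $\mathbb M_n$ is called unitarily invariant if $\|UZV\|=\|Z\|$ for all $Z\in\mathbb M_n$ and all unitary $U,V\in\mathbb M_n$. Theorem. For every unitarily invariant norm $\|\cdot\|$ on $\mathbb M_n$ and every $Z\in\mathbb M_n$, $$\bigl\||Z|_{\mathrm{sym}}\bigr\|\ \le\ \bigl\||Z|_{\mathrm{qsym}}\bigr\|\ \le\ \sqrt2\,\bigl\||Z|_{\mathrm{sym}}\bigr\|.$$ Moreover, both constants $1$ and $\sqrt2$ are sharp, for every unitarily invariant norm on $\mathbb M_n$: if $n\ge1$ and $c\in\mathbb R$ satisfies $c\,\||Z|_{\mathrm{sym}}\|\le\||Z|_{\mathrm{qsym}}\|$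 for all $Z\in\mathbb M_n$, then $c\le1$; if $n\ge2$ and $C\in\mathbb R$ satisfies $\||Z|_{\mathrm{qsym}}\|\le C\,\||Z|_{\mathrm{sym}}\|$ for all $Z\in\mathbb M_n$, then $C\ge\sqrt2$. -/

import Mathlib

open scoped Matrix MatrixOrder ComplexStarModule

noncomputable section

/-- A norm on the complex vector space `M_n` of `n × n` complex matrices (that is, a seminorm
vanishing only at `0`) which is unitarily invariant: `‖U Z V‖ = ‖Z‖` for all unitary `U`, `V`. -/
structure IsUnitarilyInvariantNorm {n : ℕ} (N : Seminorm ℂ (Matrix (Fin n) (Fin n) ℂ)) :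
    Prop where
  eq_zero_of_map_eq_zero : ∀ Z : Matrix (Fin n) (Fin n) ℂ, N Z = 0 → Z = 0
  map_unitary_mul_mul_unitary : ∀ U ∈ Matrix.unitaryGroup (Fin n) ℂ,
    ∀ V ∈ Matrix.unitaryGroup (Fin n) ℂ, ∀ Z : Matrix (Fin n) (Fin n) ℂ,
      N (U * Z * V) = N Z

/-- The arithmetic symmetric modulus `(|Z| + |Z*|) / 2`, where `|Z| = (Z* Z)^{1/2}` is
`CFC.abs Z`. -/
def symModulus {n : ℕ} (Z : Matrix (Fin n) (Fin n) ℂ) : Matrix (Fin n) (Fin n) ℂ :=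
  (1 / 2 : ℂ) • (CFC.abs Z + CFC.abs Zᴴ)

/-- The quadratic symmetric modulus `((Re Z)² + (Im Z)²)^{1/2}`, where `Re Z = (Z + Z*) / 2` and
`Im Z = (Z - Z*) / (2i)` are the parts of the Cartesian decomposition `Z = Re Z + i Im Z`. -/
def qsymModulus {n : ℕ} (Z : Matrix (Fin n) (Fin n) ℂ) : Matrix (Fin n) (Fin n) ℂ :=
  CFC.sqrt ((ℜ Z : Matrix (Fin n) (Fin n) ℂ) ^ 2 + (ℑ Z : Matrix (Fin n) (Fin n) ℂ) ^ 2)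

end

section
open scoped ComplexOrder
variable {n : ℕ} {N : Seminorm ℂ (Matrix (Fin n) (Fin n) ℂ)}

/-! Put `A = |Z|` and `B = |Z*|`. Since `(Re Z)² + (Im Z)² = (A² + B²)/2`, the claim compares `(A +
B)/2` with `((A² + B²)/2)^{1/2}`. The lower bound already holds in the Loewner order, because the
difference of squares is `(A - B)²/4` and the square root is operator monotone; unitarily invariant
norms are monotone on positive matrices. The upper bound reduces to `‖(A² + B²)^{1/2}‖ ≤ ‖A + B‖`
for `A, B ≥ 0` (`map_sqrt_le`). An AM-GM inequality dominates the root by an average of `A + B` and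
matrices `L (A + B) Lᴴ` with `L` a contraction. Each of these has norm at most `‖A + B‖`, since a
contraction is an average of two unitaries. Sharpness is seen on `Z = 1` and on an off-diagonal
matrix unit. -/

/-! ### Polar decomposition and contractions -/

theorem LinearMap.exists_linearIsometry_comp_eq {V : Type*} [NormedAddCommGroup V]
    [InnerProductSpace ℂ V] [FiniteDimensional ℂ V] {f g : V →ₗ[ℂ] V}
    (h : ∀ x, ‖f x‖ = ‖g x‖) : ∃ e : V →ₗᵢ[ℂ] V, e.toLinearMap ∘ₗ g = f := by
  have hker : LinearMap.ker g ≤ LinearMap.ker f := by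
    intro x hx
    rw [LinearMap.mem_ker] at hx ⊢
    rw [← norm_eq_zero, h, hx, norm_zero]
  -- The map `g x ↦ f x`, isometric on the range of `g`; finite dimension lets it extend to all of
  -- `V`.
  let k : LinearMap.range g →ₗ[ℂ] V :=
    (LinearMap.ker g).liftQ f hker ∘ₗ g.quotKerEquivRange.symm.toLinearMap
  have hk : ∀ x, k ⟨g x, LinearMap.mem_range_self g x⟩ = f x := by
    intro x
    simp only [k, LinearMap.comp_apply, LinearEquiv.coe_coe]
    have := g.quotKerEquivRange_symm_apply_image x (LinearMap.mem_range_self g x)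
    rw [this]
    simp
  have hk' : ∀ y, ‖k y‖ = ‖y‖ := by
    rintro ⟨_, x, rfl⟩
    exact (congrArg _ (hk x)).trans (h x)
  let ki : LinearMap.range g →ₗᵢ[ℂ] V := ⟨k, hk'⟩
  exact ⟨ki.extend, LinearMap.ext fun x =>
    (ki.extend_apply ⟨g x, LinearMap.mem_range_self g x⟩).trans (hk x)⟩

theorem Matrix.exists_unitary_mul_of_conjTranspose_mul_self_eq
    {X Y : Matrix (Fin n) (Fin n) ℂ} (h : Xᴴ * X = Yᴴ * Y) :
    ∃ U ∈ Matrix.unitaryGroup (Fin n) ℂ, X = U * Y := by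
  have hsq : ∀ (W : Matrix (Fin n) (Fin n) ℂ) (x : EuclideanSpace ℂ (Fin n)),
      inner ℂ (W.toEuclideanLin x) (W.toEuclideanLin x)
        = inner ℂ ((Wᴴ * W).toEuclideanLin x) x := by
    intro W x
    rw [← LinearMap.adjoint_inner_left, ← Matrix.toEuclideanLin_conjTranspose_eq_adjoint,
      Matrix.toLpLin_mul_same, LinearMap.comp_apply]
  have hnorm : ∀ x, ‖X.toEuclideanLin x‖ = ‖Y.toEuclideanLin x‖ := by
    intro x
    have : inner ℂ (X.toEuclideanLin x) (X.toEuclideanLin x)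
        = inner ℂ (Y.toEuclideanLin x) (Y.toEuclideanLin x) := by rw [hsq, hsq, h]
    rw [inner_self_eq_norm_sq_to_K, inner_self_eq_norm_sq_to_K] at this
    have h2 : ‖X.toEuclideanLin x‖ ^ 2 = ‖Y.toEuclideanLin x‖ ^ 2 := by exact_mod_cast this
    exact (pow_left_inj₀ (norm_nonneg _) (norm_nonneg _) two_ne_zero).1 h2
  obtain ⟨e, he⟩ := LinearMap.exists_linearIsometry_comp_eq hnorm
  obtain ⟨U, hU⟩ := Matrix.toEuclideanLin.surjective e.toLinearMap
  refine ⟨U, ?_, ?_⟩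
  · rw [Matrix.mem_unitaryGroup_iff', Matrix.star_eq_conjTranspose]
    apply Matrix.toEuclideanLin.injective
    rw [Matrix.toLpLin_mul_same, Matrix.toLpLin_one, Matrix.toEuclideanLin_conjTranspose_eq_adjoint,
      hU]
    refine LinearMap.ext fun x => ext_inner_right ℂ fun y => ?_
    rw [LinearMap.comp_apply, LinearMap.adjoint_inner_left]
    exact e.inner_map_map x y
  · apply Matrix.toEuclideanLin.injective
    rw [Matrix.toLpLin_mul_same, hU, he]

/-- A contraction is the average of two unitary matrices. -/
theorem Matrix.exists_unitary_average {L : Matrix (Fin n) (Fin n) ℂ} (hL : Lᴴ * L ≤ 1) :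
    ∃ U ∈ Matrix.unitaryGroup (Fin n) ℂ, ∃ V ∈ Matrix.unitaryGroup (Fin n) ℂ,
      L = (1 / 2 : ℂ) • (U + V) := by
  set H := CFC.abs L with hH
  have hH0 : 0 ≤ H := CFC.abs_nonneg L
  have hHs : Hᴴ = H := hH0.isSelfAdjoint
  have hHH : H * H = Lᴴ * L := CFC.abs_mul_abs L
  obtain ⟨W, hW, hLW⟩ := Matrix.exists_unitary_mul_of_conjTranspose_mul_self_eq (X := L) (Y := H)
    (by rw [hHs, hHH])
  -- `K` commutes with `H` and `H² + K² = 1`, so `H ± iK` are unitary with average `H`, like `cos θ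
  -- ± i sin θ`.
  set K := CFC.sqrt (1 - H * H) with hK
  have h1 : 0 ≤ 1 - H * H := by rw [hHH]; exact sub_nonneg.2 hL
  have hK0 : 0 ≤ K := CFC.sqrt_nonneg _
  have hKs : Kᴴ = K := hK0.isSelfAdjoint
  have hKK : K * K = 1 - H * H := CFC.sqrt_mul_sqrt_self _ h1
  have hc : K * H = H * K := by
    have : Commute (1 - H * H) H := by
      simp [commute_iff_eq, sub_mul, mul_sub, mul_assoc]
    exact (this.cfcₙ_nnreal _).eq
  have key : ∀ z : ℂ, star z * z = 1 → star z = -z →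
      H + z • K ∈ Matrix.unitaryGroup (Fin n) ℂ := by
    intro z hz hz'
    rw [Matrix.mem_unitaryGroup_iff', Matrix.star_eq_conjTranspose, Matrix.conjTranspose_add,
      Matrix.conjTranspose_smul, hHs, hKs, add_mul, mul_add, mul_add, smul_mul_smul_comm, hz, hKK,
      hz', smul_mul_assoc, mul_smul_comm, hc]
    module
  refine ⟨W * (H + Complex.I • K), mul_mem hW (key _ (by simp) (by simp)),
    W * (H + (-Complex.I) • K), mul_mem hW (key _ (by simp) (by simp)), ?_⟩
  rw [← mul_add, ← mul_smul_comm]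
  rw [show (1 / 2 : ℂ) • (H + Complex.I • K + (H + -Complex.I • K)) = H by module]
  exact hLW

namespace IsUnitarilyInvariantNorm

theorem map_smul_add_le (N : Seminorm ℂ (Matrix (Fin n) (Fin n) ℂ))
    (X Y : Matrix (Fin n) (Fin n) ℂ) : N ((1 / 2 : ℂ) • (X + Y)) ≤ (N X + N Y) / 2 := by
  have := map_add_le_add N X Y
  rw [map_smul_eq_mul]
  norm_num
  linarith

theorem map_contraction_mul_mul_le (hN : IsUnitarilyInvariantNorm N)
    {L : Matrix (Fin n) (Fin n) ℂ} (hL : Lᴴ * L ≤ 1) (X : Matrix (Fin n) (Fin n) ℂ) :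
    N (L * X * Lᴴ) ≤ N X := by
  obtain ⟨U, hU, V, hV, rfl⟩ := Matrix.exists_unitary_average hL
  have h1 : N ((1 / 2 : ℂ) • (U + V) * X) ≤ N X := by
    rw [smul_mul_assoc, add_mul]
    refine (map_smul_add_le N _ _).trans ?_
    have h1 := hN.map_unitary_mul_mul_unitary U hU 1 (one_mem _) X
    have h2 := hN.map_unitary_mul_mul_unitary V hV 1 (one_mem _) X
    rw [mul_one] at h1 h2
    linarith
  refine le_trans ?_ h1
  generalize (1 / 2 : ℂ) • (U + V) * X = Y
  rw [Matrix.conjTranspose_smul, Matrix.conjTranspose_add, mul_smul_comm, mul_add]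
  rw [show star (1 / 2 : ℂ) = 1 / 2 by simp]
  refine (map_smul_add_le N _ _).trans ?_
  have h1 := hN.map_unitary_mul_mul_unitary 1 (one_mem _) _ (Unitary.star_mem hU) Y
  have h2 := hN.map_unitary_mul_mul_unitary 1 (one_mem _) _ (Unitary.star_mem hV) Y
  rw [one_mul, Matrix.star_eq_conjTranspose] at h1 h2
  linarith

end IsUnitarilyInvariantNorm

open scoped Matrix.Norms.L2Operator in
theorem Matrix.sqrt_le_sqrt_of_le {X Y : Matrix (Fin n) (Fin n) ℂ} (h : X ≤ Y) :
    CFC.sqrt X ≤ CFC.sqrt Y := CFC.sqrt_le_sqrt X Y h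


theorem Matrix.posDef_add_smul_one {X : Matrix (Fin n) (Fin n) ℂ} (hX : 0 ≤ X) {ε : ℝ}
    (hε : 0 < ε) : (X + (ε : ℂ) • (1 : Matrix (Fin n) (Fin n) ℂ)).PosDef :=
  Matrix.PosDef.posSemidef_add (Matrix.nonneg_iff_posSemidef.1 hX)
    (Matrix.PosDef.one.smul (by exact_mod_cast hε : (0 : ℂ) < ε))

theorem Matrix.isUnit_sqrt_of_posDef {X : Matrix (Fin n) (Fin n) ℂ} (hX : X.PosDef) :
    IsUnit (CFC.sqrt X).det := by
  have h : CFC.sqrt X * CFC.sqrt X = X := CFC.sqrt_mul_sqrt_self _ hX.posSemidef.nonneg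
  have h2 := (Matrix.isUnit_iff_isUnit_det _).1 hX.isUnit
  rw [← h, Matrix.det_mul] at h2
  exact isUnit_of_mul_isUnit_left h2

theorem le_of_forall_pos_le_add_mul {a b c : ℝ} (h : ∀ ε > 0, a ≤ b + ε * c) : a ≤ b := by
  by_contra! hab
  have hc : 0 < c := by
    have := h 1 one_pos
    linarith
  have := h ((a - b) / (2 * c)) (by apply div_pos <;> linarith)
  rw [div_mul_eq_mul_div, mul_div_mul_right _ _ hc.ne'] at this
  linarith

/-- The columns `W = (W₁, W₂)` and `V = (V₁, V₂)` are isometries and `L = WᴴV`, so `1 - LᴴL = (V -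
WL)ᴴ(V - WL)`. -/
theorem Matrix.conjTranspose_mul_self_le_one {W₁ W₂ V₁ V₂ : Matrix (Fin n) (Fin n) ℂ}
    (hW : W₁ᴴ * W₁ + W₂ᴴ * W₂ = 1) (hV : V₁ᴴ * V₁ + V₂ᴴ * V₂ = 1) :
    (W₁ᴴ * V₁ + W₂ᴴ * V₂)ᴴ * (W₁ᴴ * V₁ + W₂ᴴ * V₂) ≤ 1 := by
  set L := W₁ᴴ * V₁ + W₂ᴴ * V₂ with hL
  have hLs : Lᴴ = V₁ᴴ * W₁ + V₂ᴴ * W₂ := by simp [hL]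
  have h0 : 0 ≤ (V₁ - W₁ * L)ᴴ * (V₁ - W₁ * L) + (V₂ - W₂ * L)ᴴ * (V₂ - W₂ * L) :=
    add_nonneg (Matrix.posSemidef_conjTranspose_mul_self _).nonneg
      (Matrix.posSemidef_conjTranspose_mul_self _).nonneg
  rw [← sub_nonneg]
  refine h0.trans_eq ?_
  calc _ = (V₁ᴴ * V₁ + V₂ᴴ * V₂) - (V₁ᴴ * W₁ + V₂ᴴ * W₂) * L - Lᴴ * (W₁ᴴ * V₁ + W₂ᴴ * V₂)
        + Lᴴ * (W₁ᴴ * W₁ + W₂ᴴ * W₂) * L := by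
        rw [Matrix.conjTranspose_sub, Matrix.conjTranspose_sub, Matrix.conjTranspose_mul,
          Matrix.conjTranspose_mul]
        noncomm_ring
    _ = _ := by
        rw [hW, hV, ← hLs, ← hL]
        noncomm_ring

/-! ### Monotonicity of the norm and the inequality for two positive matrices -/

namespace IsUnitarilyInvariantNorm

theorem map_add_smul_one_le (N : Seminorm ℂ (Matrix (Fin n) (Fin n) ℂ))
    (X : Matrix (Fin n) (Fin n) ℂ) {ε : ℝ} (hε : 0 < ε) :
    N (X + (ε : ℂ) • 1) ≤ N X + ε * N 1 := by
  refine (map_add_le_add N _ _).trans_eq ?_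
  rw [map_smul_eq_mul, Complex.norm_real, Real.norm_of_nonneg hε.le]

/-- `X = K Y Kᴴ` with `K = X^{1/2} Y^{-1/2}`, a contraction because `KᴴK = Y^{-1/2} X Y^{-1/2} ≤ 1`.
-/
theorem map_le_map_of_posDef (hN : IsUnitarilyInvariantNorm N)
    {X Y : Matrix (Fin n) (Fin n) ℂ} (hX : 0 ≤ X) (hXY : X ≤ Y) (hY : Y.PosDef) : N X ≤ N Y := by
  set P := CFC.sqrt X
  set Q := CFC.sqrt Y
  have hP : Pᴴ = P := (CFC.sqrt_nonneg X).isSelfAdjoint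
  have hQ : Qᴴ = Q := (CFC.sqrt_nonneg Y).isSelfAdjoint
  have hPP : P * P = X := CFC.sqrt_mul_sqrt_self _ hX
  have hQQ : Q * Q = Y := CFC.sqrt_mul_sqrt_self _ (hX.trans hXY)
  have hu : IsUnit Q.det := Matrix.isUnit_sqrt_of_posDef hY
  have hQi : Q⁻¹ᴴ = Q⁻¹ := by rw [Matrix.conjTranspose_nonsing_inv, hQ]
  have hK : (P * Q⁻¹)ᴴ * (P * Q⁻¹) ≤ 1 := by
    have h := star_left_conjugate_le_conjugate hXY Q⁻¹
    rw [Matrix.star_eq_conjTranspose, hQi, ← hQQ, Matrix.nonsing_inv_mul_cancel_left _ _ hu,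
      Matrix.mul_nonsing_inv _ hu, ← hPP] at h
    rw [Matrix.conjTranspose_mul, hQi, hP]
    simpa only [mul_assoc] using h
  have h := hN.map_contraction_mul_mul_le hK Y
  have hPQ : P * Q⁻¹ * Y * (P * Q⁻¹)ᴴ = X := by
    rw [Matrix.conjTranspose_mul, hQi, hP, ← hPP, ← hQQ]
    simp only [mul_assoc, Matrix.nonsing_inv_mul_cancel_left _ _ hu,
      Matrix.mul_nonsing_inv_cancel_left _ _ hu]
  rwa [hPQ] at h

theorem map_le_map (hN : IsUnitarilyInvariantNorm N)
    {X Y : Matrix (Fin n) (Fin n) ℂ} (hX : 0 ≤ X) (hXY : X ≤ Y) : N X ≤ N Y := by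
  refine le_of_forall_pos_le_add_mul (c := N 1) fun ε hε => ?_
  refine le_trans ?_ (map_add_smul_one_le N Y hε)
  refine hN.map_le_map_of_posDef hX (hXY.trans ?_)
    (Matrix.posDef_add_smul_one (hX.trans hXY) hε)
  have := (Matrix.posDef_add_smul_one (n := n) le_rfl hε).posSemidef.nonneg
  rw [zero_add] at this
  exact le_add_of_nonneg_right this

/-- With `M = (A² + B²)^{1/2}`, `P = M⁻¹A^{3/2}` and `Q = M⁻¹B^{3/2}`, one has `P A^{1/2} + Q
B^{1/2} = M`, and AM-GM bounds `M` by `(PPᴴ + QQᴴ + A + B)/2`. The parallelogram identity splits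
`PPᴴ + QQᴴ` into `P ± Q`, each a contraction times `(A + B)^{1/2}`. -/
theorem map_sqrt_le_of_posDef (hN : IsUnitarilyInvariantNorm N)
    {A B : Matrix (Fin n) (Fin n) ℂ} (hA : A.PosDef) (hB : B.PosDef) :
    N (CFC.sqrt (A * A + B * B)) ≤ N (A + B) := by
  have hA0 := hA.posSemidef.nonneg
  have hB0 := hB.posSemidef.nonneg
  have hAs : Aᴴ = A := hA.1
  have hBs : Bᴴ = B := hB.1
  have hSp : (A + B).PosDef := hA.add hB
  have hMp : (A * A + B * B).PosDef := by
    have key : ∀ {C : Matrix (Fin n) (Fin n) ℂ}, C.PosDef → (C * C).PosDef := fun {C} hC => by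
      have := Matrix.PosDef.conjTranspose_mul_self C
        (Matrix.mulVec_injective_iff_isUnit.2 hC.isUnit)
      rwa [hC.1] at this
    exact (key hA).add (key hB)
  set S := A + B with hS
  set M := CFC.sqrt (A * A + B * B)
  set a := CFC.sqrt A
  set b := CFC.sqrt B
  set s := CFC.sqrt S
  have hM0 : 0 ≤ M := CFC.sqrt_nonneg _
  have hMs : Mᴴ = M := (CFC.sqrt_nonneg _).isSelfAdjoint
  have has : aᴴ = a := (CFC.sqrt_nonneg _).isSelfAdjoint
  have hbs : bᴴ = b := (CFC.sqrt_nonneg _).isSelfAdjoint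
  have hss : sᴴ = s := (CFC.sqrt_nonneg _).isSelfAdjoint
  have hMM : M * M = A * A + B * B := CFC.sqrt_mul_sqrt_self _ hMp.posSemidef.nonneg
  have haa : a * a = A := CFC.sqrt_mul_sqrt_self _ hA0
  have hbb : b * b = B := CFC.sqrt_mul_sqrt_self _ hB0
  have hsS : s * s = S := CFC.sqrt_mul_sqrt_self _ hSp.posSemidef.nonneg
  have hMu : IsUnit M.det := Matrix.isUnit_sqrt_of_posDef hMp
  have hsu : IsUnit s.det := Matrix.isUnit_sqrt_of_posDef hSp
  have hMi : M⁻¹ᴴ = M⁻¹ := by rw [Matrix.conjTranspose_nonsing_inv, hMs]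
  have hsi : s⁻¹ᴴ = s⁻¹ := by rw [Matrix.conjTranspose_nonsing_inv, hss]
  have hV : (a * s⁻¹)ᴴ * (a * s⁻¹) + (b * s⁻¹)ᴴ * (b * s⁻¹) = 1 := by
    calc _ = s⁻¹ * (a * a + b * b) * s⁻¹ := by
          simp only [Matrix.conjTranspose_mul, has, hbs, hsi]
          noncomm_ring
      _ = 1 := by
          rw [haa, hbb, ← hS, ← hsS, Matrix.nonsing_inv_mul_cancel_left _ _ hsu,
            Matrix.mul_nonsing_inv _ hsu]
  have hW : (A * M⁻¹)ᴴ * (A * M⁻¹) + (B * M⁻¹)ᴴ * (B * M⁻¹) = 1 := by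
    calc _ = M⁻¹ * (A * A + B * B) * M⁻¹ := by
          simp only [Matrix.conjTranspose_mul, hAs, hBs, hMi]
          noncomm_ring
      _ = 1 := by
          rw [← hMM, Matrix.nonsing_inv_mul_cancel_left _ _ hMu, Matrix.mul_nonsing_inv _ hMu]
  -- Flipping the sign of the second block keeps the column isometric and yields the contraction for
  -- `P - Q`.
  have hW' : (A * M⁻¹)ᴴ * (A * M⁻¹) + (-(B * M⁻¹))ᴴ * (-(B * M⁻¹)) = 1 := by
    rwa [Matrix.conjTranspose_neg, neg_mul_neg]
  set P := M⁻¹ * A * a with hP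
  set Q := M⁻¹ * B * b with hQ
  have conj : ∀ T : Matrix (Fin n) (Fin n) ℂ, (T * s⁻¹) * S * (T * s⁻¹)ᴴ = T * Tᴴ := by
    intro T
    rw [Matrix.conjTranspose_mul, hsi, ← hsS, ← mul_assoc (T * s⁻¹),
      Matrix.nonsing_inv_mul_cancel_right _ _ hsu, ← mul_assoc,
      Matrix.mul_nonsing_inv_cancel_right _ _ hsu]
  have h1 : N ((P + Q) * (P + Q)ᴴ) ≤ N S := by
    have h := hN.map_contraction_mul_mul_le (Matrix.conjTranspose_mul_self_le_one hW hV) S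
    rw [← conj]
    convert h using 4 <;>
    · simp only [hP, hQ, Matrix.conjTranspose_mul, hAs, hBs, hMi]
      noncomm_ring
  have h2 : N ((P - Q) * (P - Q)ᴴ) ≤ N S := by
    have h := hN.map_contraction_mul_mul_le (Matrix.conjTranspose_mul_self_le_one hW' hV) S
    rw [← conj]
    convert h using 4 <;>
    · simp only [hP, hQ, Matrix.conjTranspose_mul, Matrix.conjTranspose_neg, hAs, hBs, hMi]
      noncomm_ring
  have hPQ : P * a + Q * b = M := by
    rw [hP, hQ, mul_assoc, haa, mul_assoc _ b b, hbb, mul_assoc, mul_assoc, ← mul_add, ← hMM,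
      Matrix.nonsing_inv_mul_cancel_left _ _ hMu]
  have hPQ' : a * Pᴴ + b * Qᴴ = M := by
    have := congrArg Matrix.conjTranspose hPQ
    simpa [has, hbs, hMs] using this
  have hR : P * Pᴴ + Q * Qᴴ = (1 / 2 : ℂ) • ((P + Q) * (P + Q)ᴴ + (P - Q) * (P - Q)ᴴ) := by
    simp only [Matrix.conjTranspose_add, Matrix.conjTranspose_sub, add_mul, sub_mul, mul_add,
      mul_sub]
    module
  have hMle : M ≤ (1 / 2 : ℂ) • ((P * Pᴴ + Q * Qᴴ) + S) := by
    have h0 : 0 ≤ (P - a) * (P - a)ᴴ + (Q - b) * (Q - b)ᴴ :=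
      add_nonneg (Matrix.posSemidef_self_mul_conjTranspose _).nonneg
        (Matrix.posSemidef_self_mul_conjTranspose _).nonneg
    have h3 : (P - a) * (P - a)ᴴ + (Q - b) * (Q - b)ᴴ
        = (P * Pᴴ + Q * Qᴴ) + S - (P * a + Q * b) - (a * Pᴴ + b * Qᴴ) := by
      rw [hS, ← haa, ← hbb, Matrix.conjTranspose_sub, Matrix.conjTranspose_sub, has, hbs]
      noncomm_ring
    rw [h3, hPQ, hPQ'] at h0
    have h4 := ((Matrix.nonneg_iff_posSemidef.1 h0).smul (by norm_num : (0 : ℝ) ≤ 1 / 2)).nonneg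
    rw [← sub_nonneg]
    refine h4.trans_eq ?_
    rw [← Complex.coe_smul]
    push_cast
    module
  refine (hN.map_le_map hM0 hMle).trans ((map_smul_add_le N _ _).trans ?_)
  have := map_smul_add_le N ((P + Q) * (P + Q)ᴴ) ((P - Q) * (P - Q)ᴴ)
  rw [← hR] at this
  linarith

/-- The triangle-type inequality `‖(A² + B²)^{1/2}‖ ≤ ‖A + B‖` for positive matrices. -/
theorem map_sqrt_le (hN : IsUnitarilyInvariantNorm N)
    {A B : Matrix (Fin n) (Fin n) ℂ} (hA : 0 ≤ A) (hB : 0 ≤ B) :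
    N (CFC.sqrt (A * A + B * B)) ≤ N (A + B) := by
  refine le_of_forall_pos_le_add_mul (c := 2 * N 1) fun ε hε => ?_
  -- Shifting by `ε` makes both matrices definite and only enlarges their squares: the gain is `2εC
  -- + ε²`.
  have key : ∀ {C : Matrix (Fin n) (Fin n) ℂ}, 0 ≤ C →
      C * C ≤ (C + (ε : ℂ) • 1) * (C + (ε : ℂ) • 1) := fun {C} hC => by
    have h1 := ((Matrix.nonneg_iff_posSemidef.1 hC).smul (by positivity : (0 : ℝ) ≤ 2 * ε)).nonneg
    have h2 := ((Matrix.PosSemidef.one (n := Fin n) (R := ℂ)).smul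
      (by positivity : (0 : ℝ) ≤ ε * ε)).nonneg
    rw [← sub_nonneg]
    refine (add_nonneg h1 h2).trans_eq ?_
    rw [← Complex.coe_smul, ← Complex.coe_smul]
    simp only [add_mul, mul_add, smul_mul_assoc, mul_smul_comm, mul_one, one_mul]
    push_cast
    module
  refine (hN.map_le_map (CFC.sqrt_nonneg _)
    (Matrix.sqrt_le_sqrt_of_le (add_le_add (key hA) (key hB)))).trans ?_
  refine (hN.map_sqrt_le_of_posDef (Matrix.posDef_add_smul_one hA hε)
    (Matrix.posDef_add_smul_one hB hε)).trans ?_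
  rw [show A + (ε : ℂ) • (1 : Matrix (Fin n) (Fin n) ℂ) + (B + (ε : ℂ) • 1)
    = A + B + ((2 * ε : ℝ) : ℂ) • 1 by push_cast; module]
  refine (map_add_smul_one_le N (A + B) (by positivity)).trans_eq ?_
  ring

end IsUnitarilyInvariantNorm


/-! ### The two symmetric moduli -/

theorem qsymModulus_eq (Z : Matrix (Fin n) (Fin n) ℂ) :
    qsymModulus Z = CFC.sqrt ((1 / 2 : ℂ) • (CFC.abs Z * CFC.abs Z + CFC.abs Zᴴ * CFC.abs Zᴴ)) := by
  rw [qsymModulus, CFC.abs_mul_abs, CFC.abs_mul_abs, Matrix.star_eq_conjTranspose,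
    Matrix.star_eq_conjTranspose, Matrix.conjTranspose_conjTranspose]
  congr 1
  rw [realPart_apply_coe, imaginaryPart_apply_coe, Matrix.star_eq_conjTranspose, sq, sq]
  rw [← Complex.coe_smul, ← Complex.coe_smul]
  simp only [smul_mul_smul_comm, add_mul, mul_add, sub_mul, mul_sub, smul_smul, smul_add, smul_sub]
  push_cast
  match_scalars <;> ring_nf <;> simp <;> norm_num

theorem Matrix.nonneg_mul_self {X : Matrix (Fin n) (Fin n) ℂ} (hX : 0 ≤ X) : 0 ≤ X * X := by
  have := (Matrix.posSemidef_conjTranspose_mul_self X).nonneg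
  rwa [show Xᴴ = X from hX.isSelfAdjoint] at this

theorem sqrt_smul_eq {X : Matrix (Fin n) (Fin n) ℂ} (hX : 0 ≤ X) {r : ℝ} (hr : 0 ≤ r) :
    CFC.sqrt (((r * r : ℝ) : ℂ) • X) = (r : ℂ) • CFC.sqrt X := by
  apply CFC.sqrt_unique
  · rw [smul_mul_smul_comm, CFC.sqrt_mul_sqrt_self X hX]
    push_cast
    rfl
  · rw [Complex.coe_smul]
    exact ((Matrix.nonneg_iff_posSemidef.1 (CFC.sqrt_nonneg X)).smul hr).nonneg

theorem symModulus_nonneg (Z : Matrix (Fin n) (Fin n) ℂ) : 0 ≤ symModulus Z := by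
  have := ((Matrix.nonneg_iff_posSemidef.1 (add_nonneg (CFC.abs_nonneg Z) (CFC.abs_nonneg Zᴴ))).smul
    (by norm_num : (0 : ℝ) ≤ 1 / 2)).nonneg
  rw [← Complex.coe_smul] at this
  push_cast at this
  exact this

theorem symModulus_le_qsymModulus (Z : Matrix (Fin n) (Fin n) ℂ) :
    symModulus Z ≤ qsymModulus Z := by
  rw [← CFC.sqrt_mul_self (symModulus Z) (symModulus_nonneg Z), qsymModulus_eq]
  apply Matrix.sqrt_le_sqrt_of_le
  have hs : (CFC.abs Z - CFC.abs Zᴴ)ᴴ = CFC.abs Z - CFC.abs Zᴴ :=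
    ((CFC.abs_nonneg Z).isSelfAdjoint.sub (CFC.abs_nonneg Zᴴ).isSelfAdjoint)
  have h0 := ((Matrix.posSemidef_conjTranspose_mul_self (CFC.abs Z - CFC.abs Zᴴ)).smul
    (by norm_num : (0 : ℝ) ≤ 1 / 4)).nonneg
  rw [hs] at h0
  rw [← sub_nonneg]
  refine h0.trans_eq ?_
  rw [symModulus, ← Complex.coe_smul]
  push_cast
  simp only [smul_mul_smul_comm, add_mul, mul_add, sub_mul, mul_sub]
  module

theorem symModulus_one : symModulus (1 : Matrix (Fin n) (Fin n) ℂ) = 1 := by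
  rw [symModulus, Matrix.conjTranspose_one, CFC.abs_one]
  module

theorem qsymModulus_one : qsymModulus (1 : Matrix (Fin n) (Fin n) ℂ) = 1 := by
  rw [qsymModulus_eq, Matrix.conjTranspose_one, CFC.abs_one]
  rw [show (1 / 2 : ℂ) • ((1 : Matrix (Fin n) (Fin n) ℂ) * 1 + 1 * 1) = 1 by
    rw [mul_one]; module, CFC.sqrt_one]

/-! ### Matrix units, for the sharpness of `√2` -/

theorem Matrix.single_self_nonneg (i : Fin n) :
    0 ≤ (Matrix.single i i 1 : Matrix (Fin n) (Fin n) ℂ) := by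
  have := (Matrix.posSemidef_conjTranspose_mul_self
    (Matrix.single i i 1 : Matrix (Fin n) (Fin n) ℂ)).nonneg
  simpa using this

theorem Matrix.abs_single (i j : Fin n) :
    CFC.abs (Matrix.single i j 1 : Matrix (Fin n) (Fin n) ℂ) = Matrix.single j j 1 := by
  rw [CFC.abs]
  apply CFC.sqrt_unique
  · simp [Matrix.star_eq_conjTranspose]
  · exact Matrix.single_self_nonneg j

theorem inv_sqrt_two_mul_self : (1 / 2 : ℂ) = (((Real.sqrt 2)⁻¹ * (Real.sqrt 2)⁻¹ : ℝ) : ℂ) := by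
  rw [← mul_inv, Real.mul_self_sqrt zero_le_two]
  norm_num

theorem symModulus_single {i j : Fin n} :
    symModulus (Matrix.single i j 1 : Matrix (Fin n) (Fin n) ℂ)
      = (1 / 2 : ℂ) • (Matrix.single j j 1 + Matrix.single i i 1) := by
  rw [symModulus, Matrix.conjTranspose_single, star_one, Matrix.abs_single, Matrix.abs_single]

/-- The moduli of the matrix unit and its adjoint are orthogonal projections, so their sum is a
projection, equal to its own square root. Against `symModulus_single` the ratio is `(1/√2)/(1/2) =
√2`. -/
theorem qsymModulus_single {i j : Fin n} (hij : i ≠ j) :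
    qsymModulus (Matrix.single i j 1 : Matrix (Fin n) (Fin n) ℂ)
      = (((Real.sqrt 2)⁻¹ : ℝ) : ℂ) • (Matrix.single j j 1 + Matrix.single i i 1) := by
  have h0 : 0 ≤ (Matrix.single j j 1 + Matrix.single i i 1 : Matrix (Fin n) (Fin n) ℂ) :=
    add_nonneg (Matrix.single_self_nonneg j) (Matrix.single_self_nonneg i)
  have hP : (Matrix.single j j 1 + Matrix.single i i 1 : Matrix (Fin n) (Fin n) ℂ)
      * (Matrix.single j j 1 + Matrix.single i i 1)
      = Matrix.single j j 1 + Matrix.single i i 1 := by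
    simp [add_mul, mul_add, hij, hij.symm]
  rw [qsymModulus_eq, Matrix.conjTranspose_single, star_one, Matrix.abs_single, Matrix.abs_single,
    Matrix.single_mul_single_same, Matrix.single_mul_single_same, mul_one, inv_sqrt_two_mul_self,
    sqrt_smul_eq h0 (by positivity), CFC.sqrt_unique hP h0]

end

/-- For every unitarily invariant norm on `M_n`, the norms of the arithmetic and the quadratic
symmetric moduli are equivalent with constants `1` and `√2`. For each such norm the constant `1`
is the largest possible as soon as `n ≥ 1`, and `√2` is the smallest possible as soon as
`n ≥ 2`. -/
theorem mainTheorem1 (n : ℕ) (N : Seminorm ℂ (Matrix (Fin n) (Fin n) ℂ))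
    (hN : IsUnitarilyInvariantNorm N) :
    (∀ Z : Matrix (Fin n) (Fin n) ℂ,
      N (symModulus Z) ≤ N (qsymModulus Z) ∧
        N (qsymModulus Z) ≤ Real.sqrt 2 * N (symModulus Z)) ∧
    (1 ≤ n → ∀ c : ℝ,
      (∀ Z : Matrix (Fin n) (Fin n) ℂ, c * N (symModulus Z) ≤ N (qsymModulus Z)) → c ≤ 1) ∧
    (2 ≤ n → ∀ C : ℝ,
      (∀ Z : Matrix (Fin n) (Fin n) ℂ, N (qsymModulus Z) ≤ C * N (symModulus Z)) →
        Real.sqrt 2 ≤ C) := by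
  have hpos : ∀ X : Matrix (Fin n) (Fin n) ℂ, X ≠ 0 → 0 < N X := fun X hX =>
    (apply_nonneg N X).lt_of_ne' fun h => hX (hN.eq_zero_of_map_eq_zero X h)
  have h2 : 0 < Real.sqrt 2 := by positivity
  have h22 : Real.sqrt 2 * Real.sqrt 2 = 2 := Real.mul_self_sqrt zero_le_two
  refine ⟨fun Z => ⟨hN.map_le_map (symModulus_nonneg Z) (symModulus_le_qsymModulus Z), ?_⟩,
    fun hn c hc => ?_, fun hn C hC => ?_⟩
  · have hA := CFC.abs_nonneg Z
    have hB := CFC.abs_nonneg Zᴴ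
    have h := hN.map_sqrt_le hA hB
    rw [qsymModulus_eq, inv_sqrt_two_mul_self, sqrt_smul_eq (add_nonneg (Matrix.nonneg_mul_self hA)
      (Matrix.nonneg_mul_self hB))
      (by positivity), symModulus, map_smul_eq_mul, map_smul_eq_mul, Complex.norm_real,
      Real.norm_of_nonneg (by positivity)]
    norm_num
    have h3 : (Real.sqrt 2)⁻¹ = Real.sqrt 2 * (1 / 2) := by
      field_simp
      linarith
    rw [h3, mul_assoc]
    gcongr
  · have : Nonempty (Fin n) := ⟨⟨0, hn⟩⟩
    have h := hc 1
    rw [symModulus_one, qsymModulus_one] at h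
    have := hpos 1 one_ne_zero
    nlinarith
  · let i : Fin n := ⟨0, by omega⟩
    let j : Fin n := ⟨1, by omega⟩
    have hij : i ≠ j := by simp [i, j, Fin.ext_iff]
    have h := hC (Matrix.single i j 1)
    rw [symModulus_single, qsymModulus_single hij, map_smul_eq_mul, map_smul_eq_mul,
      Complex.norm_real, Real.norm_of_nonneg (by positivity)] at h
    have hP := hpos (Matrix.single j j 1 + Matrix.single i i 1) fun h0 => by
      have := congrFun (congrFun h0 i) i
      simp [hij.symm] at this
    norm_num at h
    rw [← mul_assoc] at h
    have h3 := le_of_mul_le_mul_right h hP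
    rw [inv_le_iff_one_le_mul₀ h2] at h3
    nlinarith
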